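/- **Theorem 1.** Let $K$ be a field, $G$ a group and $\lambda\colon G\times G\to K^{\times}$ a $2$-cocycle for the trivial action of $G$ on $K^\times$, i.e. $\lambda_{g,h}\lambda_{gh,k}=\lambda_{h,k}\lambda_{g,hk}$ for all $g,h,k\in G$. Let $K_\lambda G$ be the twisted group algebra, that is, the associative $K$-algebra with $K$-basis $\{u_g \mid g\in G\}$ and multiplication determined by $u_gu_h=\lambda_{g,h}u_{gh}$, and suppose that $K_\lambda G$ is infinite (as a set). Let $U$ be the group of units of $K_\lambda G$, let $\Delta U$ be its $FC$-center, i.e. the subgroup of all elements of $U$ with only finitely many conjugates in $U$, and let $t(\Delta U)$ be the subgroup of all elements of finite order in $\Delta U$. A unit $y$ is called unipotent if $y-1$ is nilpotent. Then: 1. every unipotent element of $\Delta U$ is central in $\Delta U$; 2. every element of the commutator subgroup of $t(\Delta U)$ is unipotent and central in $\Delta U$. -/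

import Mathlib

/-- A `2`-cocycle of the group `G` with values in the commutative group `A`,
with respect to the trivial action of `G` on `A`. It need not be normalized. -/
structure TwoCocycle (G A : Type*) [Group G] [CommGroup A] where
  toFun : G → G → A
  cocycle : ∀ g h k : G, toFun g h * toFun (g * h) k = toFun h k * toFun g (h * k)

instance {G A : Type*} [Group G] [CommGroup A] : CoeFun (TwoCocycle G A) (fun _ => G → G → A) :=
  ⟨TwoCocycle.toFun⟩

/-- The twisted group algebra `K_c G`: the `K`-vector space with basis `u_g` (`g ∈ G`). Its
multiplication is the bilinear one with `u_g * u_h = c g h • u_{gh}`, see below. -/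
def TwistedGroupAlgebra {K G : Type*} [Field K] [Group G] (_c : TwoCocycle G Kˣ) : Type _ :=
  G →₀ K

namespace TwistedGroupAlgebra

section

variable {K G : Type*} [Field K] [Group G] (c : TwoCocycle G Kˣ)

noncomputable instance : AddCommGroup (TwistedGroupAlgebra c) :=
  inferInstanceAs (AddCommGroup (G →₀ K))

noncomputable instance : Module K (TwistedGroupAlgebra c) :=
  inferInstanceAs (Module K (G →₀ K))

/-- The basis `u_g`, `g ∈ G`. -/
noncomputable def u : Module.Basis G K (TwistedGroupAlgebra c) :=
  Module.Basis.ofRepr (LinearEquiv.refl K (G →₀ K))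

/-- The multiplication as a bilinear map, given on basis elements by
`(u_g, u_h) ↦ c g h • u_{gh}`. -/
noncomputable def mulBilin :
    TwistedGroupAlgebra c →ₗ[K] TwistedGroupAlgebra c →ₗ[K] TwistedGroupAlgebra c :=
  (u c).constr K fun g => (u c).constr K fun h => (c g h : K) • u c (g * h)

theorem mulBilin_u_u (g h : G) :
    mulBilin c (u c g) (u c h) = (c g h : K) • u c (g * h) := by
  simp [mulBilin]

theorem cocycle_one_left (g : G) : c 1 g = c 1 1 := by
  simpa using (c.cocycle 1 1 g).symm

theorem cocycle_one_right (g : G) : c g 1 = c 1 1 := by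
  simpa using c.cocycle g 1 1

theorem mulBilin_assoc (x y z : TwistedGroupAlgebra c) :
    mulBilin c (mulBilin c x y) z = mulBilin c x (mulBilin c y z) := by
  have h1 (g h k : G) : mulBilin c (mulBilin c (u c g) (u c h)) (u c k) =
      mulBilin c (u c g) (mulBilin c (u c h) (u c k)) := by
    have h0 := congrArg (Units.val) (c.cocycle g h k)
    simp only [Units.val_mul] at h0
    simp only [mulBilin_u_u, map_smul, LinearMap.smul_apply, smul_smul, mul_assoc g h k, h0]
  have h2 (g h : G) (z : TwistedGroupAlgebra c) :
      mulBilin c (mulBilin c (u c g) (u c h)) z =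
        mulBilin c (u c g) (mulBilin c (u c h) z) :=
    LinearMap.congr_fun ((u c).ext (h1 g h) : mulBilin c (mulBilin c (u c g) (u c h)) =
      (mulBilin c (u c g)).comp (mulBilin c (u c h))) z
  have h3 (g : G) (y z : TwistedGroupAlgebra c) :
      mulBilin c (mulBilin c (u c g) y) z = mulBilin c (u c g) (mulBilin c y z) :=
    LinearMap.congr_fun ((u c).ext (fun h => h2 g h z) :
      ((mulBilin c).flip z).comp (mulBilin c (u c g)) =
        (mulBilin c (u c g)).comp ((mulBilin c).flip z)) y
  exact LinearMap.congr_fun ((u c).ext (fun g => h3 g y z) :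
    ((mulBilin c).flip z).comp ((mulBilin c).flip y) = (mulBilin c).flip (mulBilin c y z)) x

theorem one_mulBilin (x : TwistedGroupAlgebra c) :
    mulBilin c ((((c 1 1)⁻¹ : Kˣ) : K) • u c 1) x = x := by
  refine LinearMap.congr_fun ((u c).ext fun g => ?_ :
    mulBilin c ((((c 1 1)⁻¹ : Kˣ) : K) • u c 1) = LinearMap.id) x
  rw [map_smul, LinearMap.smul_apply, mulBilin_u_u, smul_smul, cocycle_one_left c g, one_mul,
    ← Units.val_mul, inv_mul_cancel, Units.val_one, one_smul,
    LinearMap.id_apply]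

theorem mulBilin_one (x : TwistedGroupAlgebra c) :
    mulBilin c x ((((c 1 1)⁻¹ : Kˣ) : K) • u c 1) = x := by
  refine LinearMap.congr_fun ((u c).ext fun g => ?_ :
    (mulBilin c).flip ((((c 1 1)⁻¹ : Kˣ) : K) • u c 1) = LinearMap.id) x
  rw [LinearMap.flip_apply, map_smul, mulBilin_u_u, smul_smul, cocycle_one_right c g, mul_one,
    ← Units.val_mul, inv_mul_cancel, Units.val_one, one_smul,
    LinearMap.id_apply]

/-- The ring structure; the identity element is `(c 1 1)⁻¹ • u_1`. -/
noncomputable instance : Ring (TwistedGroupAlgebra c) where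
  __ := (inferInstance : AddCommGroup (TwistedGroupAlgebra c))
  mul x y := mulBilin c x y
  one := (((c 1 1)⁻¹ : Kˣ) : K) • u c 1
  mul_assoc := mulBilin_assoc c
  one_mul := one_mulBilin c
  mul_one := mulBilin_one c
  left_distrib x y z := map_add (mulBilin c x) y z
  right_distrib x y z := LinearMap.map_add₂ (mulBilin c) x y z
  zero_mul x := LinearMap.map_zero₂ (mulBilin c) x
  mul_zero x := map_zero (mulBilin c x)

noncomputable instance : Algebra K (TwistedGroupAlgebra c) :=
  Algebra.ofModule (fun r x y => LinearMap.map_smul₂ (mulBilin c) r x y)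
    (fun r x y => map_smul (mulBilin c x) r y)

theorem u_mul_u (g h : G) : u c g * u c h = (c g h : K) • u c (g * h) :=
  mulBilin_u_u c g h

end

end TwistedGroupAlgebra

/-- A unit `y` of a ring is unipotent if `y = 1 + x` with `x` nilpotent. -/
def IsUnipotentUnit {R : Type*} [Ring R] (y : Rˣ) : Prop :=
  IsNilpotent ((y : R) - 1)

/-- The `FC`-center of a group: the subgroup of the elements with finitely many conjugates. -/
def fcCenter (U : Type*) [Group U] : Subgroup U where
  carrier := {x | (conjugatesOf x).Finite}
  one_mem' := by
    refine (Set.finite_singleton (1 : U)).subset fun y hy => ?_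
    simpa [conjugatesOf] using hy
  mul_mem' {a b} ha hb := by
    refine (Set.Finite.image2 (fun x y => x * y) ha hb).subset fun y hy => ?_
    obtain ⟨g, rfl⟩ := isConj_iff.1 hy
    exact ⟨g * a * g⁻¹, isConj_iff.2 ⟨g, rfl⟩, g * b * g⁻¹, isConj_iff.2 ⟨g, rfl⟩, by group⟩
  inv_mem' {a} ha := by
    refine (Set.Finite.image (fun x => x⁻¹) ha).subset fun y hy => ?_
    obtain ⟨g, rfl⟩ := isConj_iff.1 hy
    exact ⟨g * a * g⁻¹, isConj_iff.2 ⟨g, rfl⟩, by group⟩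

theorem mem_fcCenter_iff {U : Type*} [Group U] (x : U) :
    x ∈ fcCenter U ↔ (conjugatesOf x).Finite := Iff.rfl

theorem finiteIndex_centralizer_of_mem_fcCenter {U : Type*} [Group U] {x : U}
    (hx : x ∈ fcCenter U) : (Subgroup.centralizer {x}).FiniteIndex := by
  have : Finite (conjugatesOf x) := hx
  have : Finite (U ⧸ Subgroup.centralizer {x}) := by
    refine Finite.of_injective
      (fun q => (⟨q.out * x * q.out⁻¹, isConj_iff.2 ⟨q.out, rfl⟩⟩ : conjugatesOf x)) ?_
    intro p q hpq
    have h : p.out * x * p.out⁻¹ = q.out * x * q.out⁻¹ := congrArg Subtype.val hpq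
    rw [← p.out_eq', ← q.out_eq']
    refine QuotientGroup.eq.2 (Subgroup.mem_centralizer_singleton_iff.2 ?_)
    have h' := congrArg (fun t => p.out⁻¹ * t * q.out) h
    simpa [mul_assoc] using h'.symm
  exact Subgroup.finiteIndex_of_finite_quotient

open scoped commutatorElement in
/-- In a group, the product of two elements of finite order, each with finitely many conjugates,
has finite order. -/
theorem isOfFinOrder_mul_of_mem_fcCenter {U : Type*} [Group U] {a b : U}
    (ha : a ∈ fcCenter U) (hb : b ∈ fcCenter U) (ha' : IsOfFinOrder a) (hb' : IsOfFinOrder b) :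
    IsOfFinOrder (a * b) := by
  have hfa := finiteIndex_centralizer_of_mem_fcCenter ha
  have hfb := finiteIndex_centralizer_of_mem_fcCenter hb
  let H : Subgroup U := Subgroup.closure {a, b}
  let a₁ : H := ⟨a, Subgroup.subset_closure (by simp)⟩
  let b₁ : H := ⟨b, Subgroup.subset_closure (by simp)⟩
  let C : Subgroup H := (Subgroup.centralizer {a} ⊓ Subgroup.centralizer {b}).subgroupOf H
  have hC : ∀ z ∈ C, ∀ h : H, z * h = h * z := by
    intro z hz h
    have hz1 : (z : U) * a = a * z := Subgroup.mem_centralizer_singleton_iff.1 hz.1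
    have hz2 : (z : U) * b = b * z := Subgroup.mem_centralizer_singleton_iff.1 hz.2
    have hle : H ≤ Subgroup.centralizer {(z : U)} := by
      refine (Subgroup.closure_le _).2 ?_
      rintro w (rfl | rfl)
      · exact Subgroup.mem_centralizer_singleton_iff.2 hz1.symm
      · exact Subgroup.mem_centralizer_singleton_iff.2 hz2.symm
    exact Subtype.ext (Subgroup.mem_centralizer_singleton_iff.1 (hle h.2)).symm
  have hfin : (commutatorSet H).Finite := by
    have : Finite (H ⧸ C) := Subgroup.finite_quotient_of_finiteIndex
    refine (Set.finite_range fun p : (H ⧸ C) × (H ⧸ C) => ⁅p.1.out, p.2.out⁆).subset ?_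
    rintro _ ⟨x, y, rfl⟩
    refine ⟨(x, y), ?_⟩
    obtain ⟨z, hz⟩ := QuotientGroup.mk_out_eq_mul C x
    obtain ⟨w, hw⟩ := QuotientGroup.mk_out_eq_mul C y
    have e1 : ∀ (s : C) (g h : H), ⁅g * s, h⁆ = ⁅g, h⁆ := fun s g h => by
      have := hC s s.2 h
      simp only [commutatorElement_def, mul_inv_rev]
      calc g * s * h * ((s : H)⁻¹ * g⁻¹) * h⁻¹ = g * (s * h) * (s : H)⁻¹ * g⁻¹ * h⁻¹ := by group
        _ = g * h * g⁻¹ * h⁻¹ := by rw [this]; group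
    have e2 : ∀ (s : C) (g h : H), ⁅g, h * s⁆ = ⁅g, h⁆ := fun s g h => by
      rw [← commutatorElement_inv, e1, commutatorElement_inv]
    change ⁅(x : H ⧸ C).out, (y : H ⧸ C).out⁆ = _
    rw [hz, hw, e1, e2]
  have : Finite (commutatorSet H) := hfin
  obtain ⟨m, hm, ham⟩ := ha'.exists_pow_eq_one
  obtain ⟨n, hn, hbn⟩ := hb'.exists_pow_eq_one
  have hmem : (a₁ * b₁) ^ (m * n) ∈ commutator H := by
    rw [← Abelianization.ker_of, MonoidHom.mem_ker, map_pow, map_mul, mul_pow, ← map_pow, ← map_pow]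
    have h1 : a₁ ^ (m * n) = 1 := Subtype.ext (by simp [a₁, pow_mul, ham])
    have h2 : b₁ ^ (m * n) = 1 := Subtype.ext (by simp [b₁, mul_comm m n, pow_mul, hbn])
    rw [h1, h2]; simp
  have h3 : IsOfFinOrder ((a₁ * b₁) ^ (m * n)) :=
    ((commutator H).subtype).isOfFinOrder
      (isOfFinOrder_of_finite (⟨_, hmem⟩ : commutator H))
  have h4 : IsOfFinOrder (a₁ * b₁) := h3.of_pow (Nat.mul_pos hm hn).ne'
  exact H.subtype.isOfFinOrder h4

/-- The torsion part of the `FC`-center: the subgroup of the elements of finite order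
of the `FC`-center. -/
def torsionFCCenter (U : Type*) [Group U] : Subgroup U where
  carrier := {x | x ∈ fcCenter U ∧ IsOfFinOrder x}
  one_mem' := ⟨one_mem _, IsOfFinOrder.one⟩
  mul_mem' ha hb := ⟨mul_mem ha.1 hb.1, isOfFinOrder_mul_of_mem_fcCenter ha.1 hb.1 ha.2 hb.2⟩
  inv_mem' ha := ⟨inv_mem ha.1, ha.2.inv⟩

open scoped commutatorElement

/-! An element `v` of the `FC`-center has finitely many conjugates, so conjugating it by an infinite
family of units gives the same result `z` infinitely often. Since `K_λ G` is infinite, `K` or `G` is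
infinite, and either one supplies such families. If `K` is infinite, use the units `1 + t • x` with
`t` in `K`. Subtracting two relations `(1 + t • x) * v = z * (1 + t • x)` shows that `x` commutes
with `v`. This applies to `x` nilpotent and to `x` of finite order, so in this case torsion elements
of the `FC`-center are even central in it. If `G` is infinite, infinitely many `u_g` commute with
given finitely many elements of the `FC`-center, and these `u_g` replace the scalars: `1 + x * u_g`
for nilpotent `x`, `1 - e + e * u_g` for idempotent `e` (`eq_of_infinite_isUnit_add_mul_u`). When
moreover `K` is finite, two torsion elements `a`, `b` generate a finite group whose `K`-span is a
finite ring with central idempotents. Such a ring is commutative modulo its nilpotent radical, so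
`⁅a, b⁆ - 1` is nilpotent. -/

/-! ### Finite rings with central idempotents. -/

/-- Idempotents lift modulo the nilpotent radical, so those of the quotient are central too. This
forces every Wedderburn–Artin block to have size at most one, over a finite division ring, hence
over a field. -/
theorem Finite.mem_jacobson_of_isMulCentral_idempotents {R : Type*} [Ring R] [Finite R]
    (h : ∀ e : R, IsIdempotentElem e → ∀ x, e * x = x * e) (x y : R) :
    x * y - y * x ∈ Ring.jacobson R := by
  have hJ (z : R) (hz : z ∈ RingHom.ker (Ideal.Quotient.mk (Ring.jacobson R))) :
      IsNilpotent z := by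
    obtain ⟨n, hn⟩ := IsSemiprimaryRing.isNilpotent (R := R)
    rw [Ideal.mk_ker] at hz
    refine ⟨n, ?_⟩
    have := Ideal.pow_mem_pow hz n
    rwa [hn] at this
  have hidem (e : R ⧸ Ring.jacobson R) (he : IsIdempotentElem e) (z : R ⧸ Ring.jacobson R) :
      e * z = z * e := by
    obtain ⟨e', he', rfl⟩ := exists_isIdempotentElem_eq_of_ker_isNilpotent
      (Ideal.Quotient.mk (Ring.jacobson R)) hJ e (Ideal.Quotient.mk_surjective e) he
    obtain ⟨z, rfl⟩ := Ideal.Quotient.mk_surjective z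
    rw [← map_mul, ← map_mul, h e' he']
  obtain ⟨n, D, d, _, hd, ⟨φ⟩⟩ :=
    IsSemisimpleRing.exists_ringEquiv_pi_matrix_divisionRing (R ⧸ Ring.jacobson R)
  have hcomm (a b : R ⧸ Ring.jacobson R) : a * b = b * a := by
    apply φ.injective
    rw [map_mul, map_mul]
    funext i
    have hfin : Finite (D i) := by
      have : Finite (R ⧸ Ring.jacobson R) :=
        Finite.of_surjective _ Ideal.Quotient.mk_surjective
      refine Finite.of_injective
        (fun t : D i => φ.symm (Pi.single i (Matrix.diagonal fun _ => t))) ?_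
      intro s t hst
      have h1 := Pi.single_injective i (φ.symm.injective hst)
      have := congrFun (congrFun h1 0) 0
      simpa using this
    have hsub : Subsingleton (Fin (d i)) := by
      refine ⟨fun j k => ?_⟩
      by_contra hjk
      -- For `j ≠ k` the idempotent `E_jj` does not commute with `E_jk`.
      have he : IsIdempotentElem (φ.symm (Pi.single i (Matrix.single j j (1 : D i)))) := by
        rw [IsIdempotentElem, ← map_mul, ← Pi.single_mul, Matrix.single_mul_single_same, one_mul]
      have h2 := hidem _ he (φ.symm (Pi.single i (Matrix.single j k (1 : D i))))
      rw [← map_mul, ← map_mul, ← Pi.single_mul, ← Pi.single_mul] at h2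
      have h3 := Pi.single_injective i (φ.symm.injective h2)
      rw [Matrix.single_mul_single_same, Matrix.single_mul_single_of_ne _ _ _ _ (Ne.symm hjk)] at h3
      have := congrFun (congrFun h3 j) k
      simp at this
    ext j k
    obtain rfl := Subsingleton.elim j k
    simp only [Pi.mul_apply, Matrix.mul_apply]
    refine Finset.sum_congr rfl fun l _ => ?_
    obtain rfl := Subsingleton.elim j l
    have := Finite.isDomain_to_isField (D i)
    exact this.mul_comm _ _
  rw [← Ideal.Quotient.eq_zero_iff_mem, map_sub, map_mul, map_mul, hcomm, sub_self]

/-! ### Infinite families of units, and the case of an infinite field. -/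

theorem exists_infinite_mul_eq_mul_of_mem_fcCenter {R ι : Type*} [Ring R] [Infinite ι]
    (f : ι → Rˣ) {v : Rˣ} (hv : v ∈ fcCenter Rˣ) :
    ∃ z : R, {i | (f i : R) * v = z * f i}.Infinite := by
  have : Finite (conjugatesOf v) := hv
  obtain ⟨z, hz⟩ := Finite.exists_infinite_fiber
    (fun i => (⟨f i * v * (f i)⁻¹, isConj_iff.2 ⟨f i, rfl⟩⟩ : conjugatesOf v))
  refine ⟨(z : Rˣ), (Set.infinite_coe_iff.1 hz).mono fun i hi => ?_⟩
  have hi' : f i * v * (f i)⁻¹ = z := congrArg Subtype.val hi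
  change (f i : R) * v = (z : Rˣ) * f i
  rw [← Units.val_mul, ← Units.val_mul, ← hi']
  simp

theorem commute_of_infinite_isUnit_one_add_smul {K A : Type*} [Field K] [Ring A] [Algebra K A]
    {x : A} (hx : {t : K | IsUnit (1 + t • x)}.Infinite) {v : Aˣ} (hv : v ∈ fcCenter Aˣ) :
    x * v = v * x := by
  have := hx.to_subtype
  obtain ⟨z, hz⟩ := exists_infinite_mul_eq_mul_of_mem_fcCenter
    (fun t : {t : K | IsUnit (1 + t • x)} => t.2.unit) hv
  obtain ⟨s, hs, t, ht, hst⟩ := hz.nontrivial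
  simp only [Set.mem_ofPred_eq, IsUnit.unit_spec, add_mul, mul_add, one_mul, mul_one,
    smul_mul_assoc, mul_smul_comm] at hs ht
  have h1 : ((s : K) - t) • (x * v - z * x) = 0 := by
    have h2 : (v : A) + (s : K) • (x * v) - (v + (t : K) • (x * v)) =
      z + (s : K) • (z * x) - (z + (t : K) • (z * x)) := by rw [hs, ht]
    rw [smul_sub, sub_smul, sub_smul, sub_eq_zero]
    simpa using h2
  have h3 : x * v = z * x :=
    sub_eq_zero.1 ((smul_eq_zero.1 h1).resolve_left
      (sub_ne_zero.2 fun h => hst (Subtype.ext h)))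
  have h4 : (v : A) = z := by simpa [h3] using hs
  rw [h3, h4]

theorem infinite_isUnit_one_add_smul_of_isNilpotent {K A : Type*} [Field K] [Infinite K] [Ring A]
    [Algebra K A] {x : A} (hx : IsNilpotent x) : {t : K | IsUnit (1 + t • x)}.Infinite := by
  have : {t : K | IsUnit (1 + t • x)} = Set.univ :=
    Set.eq_univ_of_forall fun t => (hx.smul t).isUnit_one_add
  rw [this]
  exact Set.infinite_univ

/-- By the geometric sum, `1 + t • x` divides `1 - (-t • x) ^ n`, which is the scalar `1 - (-t) ^ n`
and vanishes for finitely many `t` only. -/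
theorem infinite_isUnit_one_add_smul_of_pow_eq_one {K A : Type*} [Field K] [Infinite K] [Ring A]
    [Algebra K A] {x : A} {n : ℕ} (hn : 0 < n) (hx : x ^ n = 1) :
    {t : K | IsUnit (1 + t • x)}.Infinite := by
  have hfin : {t : K | (-t) ^ n = 1}.Finite := by
    have hp : (Polynomial.X ^ n - Polynomial.C (1 : K)) ≠ 0 := Polynomial.X_pow_sub_C_ne_zero hn 1
    refine ((Polynomial.finite_setOfPred_isRoot hp).preimage neg_injective.injOn).subset
      fun t ht => ?_
    simpa [Polynomial.IsRoot, sub_eq_zero] using ht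
  refine hfin.infinite_compl.mono fun t ht => ?_
  have h1 : IsUnit (1 - ((-t) • x) ^ n) := by
    rw [smul_pow, hx, ← Algebra.algebraMap_eq_smul_one, ← map_one (algebraMap K A), ← map_sub]
    exact (IsUnit.mk0 _ (sub_ne_zero.2 fun h => ht h.symm)).map _
  have h2 : Commute (1 - (-t) • x) (∑ i ∈ Finset.range n, ((-t) • x) ^ i) :=
    Commute.sum_right _ _ _ fun i _ => ((Commute.one_left _).sub_left (.refl _)).pow_right i
  rw [← mul_neg_geom_sum, h2.isUnit_mul_iff] at h1
  simpa using h1.1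

/-! ### The case of an infinite group. -/

namespace TwistedGroupAlgebra

variable {K G : Type*} [Field K] [Group G] (c : TwoCocycle G Kˣ)

theorem isUnit_u (g : G) : IsUnit (u c g) := by
  have h (g h : G) (hgh : g * h = 1) :
      u c g * (((c g h)⁻¹ * (c 1 1)⁻¹ : Kˣ) : K) • u c h = 1 := by
    rw [mul_smul_comm, u_mul_u, smul_smul, hgh, ← Units.val_mul]
    change _ = (((c 1 1)⁻¹ : Kˣ) : K) • u c 1
    congr 2
    rw [mul_comm (c g h)⁻¹, mul_assoc, inv_mul_cancel, mul_one]
  have h1 := h g g⁻¹ (mul_inv_cancel g)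
  have h2 := h g⁻¹ g (inv_mul_cancel g)
  rw [mul_smul_comm, ← smul_mul_assoc] at h2
  exact isUnit_iff_exists_and_exists.2 ⟨⟨_, h1⟩, ⟨_, h2⟩⟩

theorem repr_mul_u (x : TwistedGroupAlgebra c) (h g : G) :
    (u c).repr (x * u c g) (h * g) = (u c).repr x h * c h g := by
  have : (u c).coord (h * g) ∘ₗ LinearMap.mulRight K (u c g) =
      LinearMap.mulRight K (c h g : K) ∘ₗ (u c).coord h := by
    refine (u c).ext fun k => ?_
    simp only [LinearMap.comp_apply, LinearMap.mulRight_apply, u_mul_u]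
    by_cases hk : k = h
    · subst hk; simp
    · simp [hk]
  exact LinearMap.congr_fun this x

/-- Right multiplication by `u_g` translates supports by `g`: if `k` is in the support of `x`, then
`k * g` is in the finite support of `y` for every such `g`. -/
theorem eq_zero_of_infinite_mul_u_eq {x y : TwistedGroupAlgebra c}
    (h : {g | x * u c g = y}.Infinite) : x = 0 := by
  by_contra hx
  obtain ⟨k, hk⟩ : ∃ k, (u c).repr x k ≠ 0 := by
    by_contra! h0
    exact hx ((u c).repr.map_eq_zero_iff.1 (Finsupp.ext h0))
  refine h (((((u c).repr y).support.finite_toSet).preimage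
    (mul_right_injective k).injOn).subset fun g hg => ?_)
  simp only [Set.mem_preimage, Finset.mem_coe, Finsupp.mem_support_iff]
  rw [← (hg : x * u c g = y), repr_mul_u]
  exact mul_ne_zero hk (c k g).ne_zero

/-- If `u_g` and `u_{g₀}` conjugate the tuple `w` in the same way, then `u_g * u_{g₀}⁻¹`, a scalar
multiple of `u_{g g₀⁻¹}`, centralizes it. Only finitely many conjugate tuples exist. -/
theorem infinite_commute_u [Infinite G] {ι : Type*} [Finite ι]
    (w : ι → (TwistedGroupAlgebra c)ˣ) (hw : ∀ i, w i ∈ fcCenter (TwistedGroupAlgebra c)ˣ) :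
    {g | ∀ i, Commute (u c g) (w i)}.Infinite := by
  have (i : ι) : Finite (conjugatesOf (w i)) := hw i
  let U (g : G) := (isUnit_u c g).unit
  obtain ⟨z, hz⟩ := Finite.exists_infinite_fiber
    (fun g i => (⟨(U g)⁻¹ * w i * U g, isConj_iff.2 ⟨(U g)⁻¹, by simp⟩⟩ : conjugatesOf (w i)))
  obtain ⟨g₀, hg₀⟩ := (Set.infinite_coe_iff.1 hz).nonempty
  have key (g : G) (hg : (fun i => (⟨(U g)⁻¹ * w i * U g, isConj_iff.2 ⟨(U g)⁻¹, by simp⟩⟩ :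
      conjugatesOf (w i))) = z) (i : ι) : Commute (u c (g * g₀⁻¹)) (w i) := by
    have h1 : (U g)⁻¹ * w i * U g = (U g₀)⁻¹ * w i * U g₀ :=
      congrArg Subtype.val (congrFun (hg.trans hg₀.symm) i)
    have h2 : Commute (U g * (U g₀)⁻¹) (w i) := by
      have h3 := congrArg (fun t => U g * t * (U g₀)⁻¹) h1
      simp only [mul_assoc, mul_inv_cancel_left, mul_inv_cancel, mul_one] at h3
      rw [Commute, SemiconjBy, mul_assoc, ← h3]
    have h4 : ((U g * (U g₀)⁻¹ : (TwistedGroupAlgebra c)ˣ) : TwistedGroupAlgebra c) =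
        (((c (g * g₀⁻¹) g₀)⁻¹ : Kˣ) : K) • u c (g * g₀⁻¹) := by
      rw [Units.val_mul, Units.mul_inv_eq_iff_eq_mul, smul_mul_assoc]
      change u c g = _ • (u c (g * g₀⁻¹) * u c g₀)
      rw [u_mul_u, smul_smul, ← Units.val_mul]
      simp
    have h5 := h2.units_val
    rw [h4] at h5
    have h6 := h5.smul_left ((c (g * g₀⁻¹) g₀ : Kˣ) : K)
    rwa [smul_smul, ← Units.val_mul, mul_inv_cancel, Units.val_one, one_smul] at h6
  refine (((Set.infinite_coe_iff.1 hz).image (mul_left_injective g₀⁻¹).injOn)).mono ?_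
  rintro _ ⟨g, hg, rfl⟩
  exact key g hg

/-- With a common conjugate `z`, the relations read `(q * v - z * q) * u_g = z * p - p * v` for
infinitely many `g`; the right side does not depend on `g`, so both sides vanish. -/
theorem eq_of_infinite_isUnit_add_mul_u {p q : TwistedGroupAlgebra c}
    {v : (TwistedGroupAlgebra c)ˣ} (hv : v ∈ fcCenter (TwistedGroupAlgebra c)ˣ)
    (h : {g | IsUnit (p + q * u c g) ∧ Commute (u c g) v}.Infinite) :
    ∃ z, p * v = z * p ∧ q * v = z * q := by
  have := h.to_subtype
  obtain ⟨z, hz⟩ := exists_infinite_mul_eq_mul_of_mem_fcCenter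
    (fun g : {g | IsUnit (p + q * u c g) ∧ Commute (u c g) v} => g.2.1.unit) hv
  have key : {g | (q * v - z * q) * u c g = z * p - p * v}.Infinite := by
    refine (hz.image Subtype.val_injective.injOn).mono ?_
    rintro _ ⟨g, hg, rfl⟩
    simp only [Set.mem_ofPred_eq, IsUnit.unit_spec, add_mul, mul_add, mul_assoc] at hg
    simp only [Set.mem_ofPred_eq, sub_mul, mul_assoc]
    rw [sub_eq_sub_iff_add_eq_add, add_comm, ← g.2.2.eq]
    exact hg
  have h0 := eq_zero_of_infinite_mul_u_eq c key
  obtain ⟨g, hg⟩ := key.nonempty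
  rw [Set.mem_ofPred_eq, h0, zero_mul] at hg
  exact ⟨z, (sub_eq_zero.1 hg.symm).symm, sub_eq_zero.1 h0⟩

theorem commute_of_isNilpotent {x : TwistedGroupAlgebra c}
    (hx : IsNilpotent x) {v : (TwistedGroupAlgebra c)ˣ}
    (hv : v ∈ fcCenter (TwistedGroupAlgebra c)ˣ)
    (h : {g | Commute (u c g) x ∧ Commute (u c g) v}.Infinite) : x * v = v * x := by
  obtain ⟨z, h1, h2⟩ := eq_of_infinite_isUnit_add_mul_u c (p := 1) (q := x) hv
    (h.mono fun g hg => ⟨(hg.1.symm.isNilpotent_mul_right hx).isUnit_one_add, hg.2⟩)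
  rw [one_mul, mul_one] at h1
  rw [h2, h1]

theorem commute_of_isIdempotentElem {e : TwistedGroupAlgebra c}
    (he : IsIdempotentElem e) {v : (TwistedGroupAlgebra c)ˣ}
    (hv : v ∈ fcCenter (TwistedGroupAlgebra c)ˣ)
    (h : {g | Commute (u c g) e ∧ Commute (u c g) v}.Infinite) : e * v = v * e := by
  have hunit {g : G} (hg : Commute (u c g) e) : IsUnit (1 - e + e * u c g) := by
    obtain ⟨w, hw⟩ := isUnit_u c g
    have h4 : Commute (w : TwistedGroupAlgebra c) e := hw ▸ hg
    have h5 : Commute ((w⁻¹ : (TwistedGroupAlgebra c)ˣ) : TwistedGroupAlgebra c) e :=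
      h4.units_inv_left
    -- The inverse of `1 - e + e * u_g` is `1 - e + e * u_g⁻¹`.
    have aux (a b : TwistedGroupAlgebra c) (ha : Commute a e) (hab : a * b = 1) :
        (1 - e + e * a) * (1 - e + e * b) = 1 := by
      have e1 : e * (e * b) = e * b := by rw [← mul_assoc, he.eq]
      have e2 : e * a * e = e * a := by rw [mul_assoc, ha.eq, ← mul_assoc, he.eq]
      have e3 : e * a * (e * b) = e := by rw [← mul_assoc, e2, mul_assoc, hab, mul_one]
      simp only [add_mul, sub_mul, mul_add, mul_sub, one_mul, mul_one, e1, e2, e3, he.eq]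
      abel
    rw [← hw]
    exact isUnit_iff_exists_and_exists.2 ⟨⟨_, aux _ _ h4 w.mul_inv⟩, ⟨_, aux _ _ h5 w.inv_mul⟩⟩
  obtain ⟨z, h1, h2⟩ := eq_of_infinite_isUnit_add_mul_u c (p := 1 - e) (q := e) hv
    (h.mono fun g hg => ⟨hunit hg.1, hg.2⟩)
  have h3 : (v : TwistedGroupAlgebra c) = z := by
    have := congrArg₂ (· + ·) h1 h2
    simpa [← add_mul, ← mul_add] using this
  rw [h2, h3]

end TwistedGroupAlgebra

/-! ### Finiteness of torsion subgroups, and closure properties of unipotent units. -/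

/-- The elements of `H` centralizing `a` and `b` form a central subgroup `C` of finite index. By
Schreier's lemma `C` is finitely generated; being abelian and torsion, it is finite. -/
theorem finite_closure_pair_of_mem_torsionFCCenter {U : Type*} [Group U] {a b : U}
    (ha : a ∈ torsionFCCenter U) (hb : b ∈ torsionFCCenter U) :
    Finite (Subgroup.closure {a, b} : Subgroup U) := by
  have hfa := finiteIndex_centralizer_of_mem_fcCenter ha.1
  have hfb := finiteIndex_centralizer_of_mem_fcCenter hb.1
  let H : Subgroup U := Subgroup.closure {a, b}
  have hH : H ≤ torsionFCCenter U := by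
    refine (Subgroup.closure_le _).2 ?_
    rintro w (rfl | rfl)
    exacts [ha, hb]
  let C : Subgroup H := (Subgroup.centralizer {a} ⊓ Subgroup.centralizer {b}).subgroupOf H
  have hC (z : C) (h : H) : (z : H) * h = h * z := by
    have hz1 : ((z : H) : U) * a = a * z := Subgroup.mem_centralizer_singleton_iff.1 z.2.1
    have hz2 : ((z : H) : U) * b = b * z := Subgroup.mem_centralizer_singleton_iff.1 z.2.2
    have hle : H ≤ Subgroup.centralizer {((z : H) : U)} := by
      refine (Subgroup.closure_le _).2 ?_
      rintro w (rfl | rfl)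
      · exact Subgroup.mem_centralizer_singleton_iff.2 hz1.symm
      · exact Subgroup.mem_centralizer_singleton_iff.2 hz2.symm
    exact Subtype.ext (Subgroup.mem_centralizer_singleton_iff.1 (hle h.2)).symm
  have hHfg : Group.FG H := by
    rw [Group.fg_iff_subgroup_fg]
    exact (Subgroup.fg_iff _).2 ⟨{a, b}, rfl, Set.toFinite _⟩
  have hfg : Group.FG C := inferInstance
  let _ : CommGroup C := { mul_comm := fun x y => Subtype.ext (hC x y) }
  have hfin : Finite C := by
    refine CommGroup.finite_of_fg_isMulTorsion C fun x => ?_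
    have h1 : IsOfFinOrder ((x : H) : U) := (hH (x : H).2).2
    exact Submonoid.isOfFinOrder_coe.1 (Submonoid.isOfFinOrder_coe.1 h1)
  have : Finite (H ⧸ C) := Subgroup.finite_quotient_of_finiteIndex
  exact Finite.of_equiv _ (Subgroup.groupEquivQuotientProdSubgroup (s := C)).symm

theorem IsUnipotentUnit.mul {R : Type*} [Ring R] {y z : Rˣ} (hy : IsUnipotentUnit y)
    (hz : IsUnipotentUnit z) (hyz : Commute y z) : IsUnipotentUnit (y * z) := by
  have h : Commute (y : R) z := hyz.units_val
  have h1 : Commute ((y : R) - 1) z := h.sub_left (.one_left _)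
  have : ((y * z : Rˣ) : R) - 1 = ((y : R) - 1) * z + (z - 1) := by
    rw [Units.val_mul]; noncomm_ring
  rw [IsUnipotentUnit, this]
  exact (((h1.sub_right (.one_right _))).mul_left
    ((Commute.refl _).sub_right (.one_right _))).isNilpotent_add
    (h1.isNilpotent_mul_right hy) hz

theorem IsUnipotentUnit.inv {R : Type*} [Ring R] {y : Rˣ} (hy : IsUnipotentUnit y) :
    IsUnipotentUnit y⁻¹ := by
  have h1 : Commute ((y : R) - 1) ((-y⁻¹ : Rˣ) : R) := by
    simp only [Commute, SemiconjBy, sub_mul, mul_sub, Units.val_neg, mul_neg, neg_mul, Units.mul_inv,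
      Units.inv_mul, one_mul, mul_one]
    abel
  have : ((y⁻¹ : Rˣ) : R) - 1 = ((y : R) - 1) * ((-y⁻¹ : Rˣ) : R) := by
    simp [sub_mul]
  rw [IsUnipotentUnit, this]
  exact h1.isNilpotent_mul_right hy

/-! ### Unipotent units and commutators in the twisted group algebra. -/

namespace TwistedGroupAlgebra

variable {K G : Type*} [Field K] [Group G] (c : TwoCocycle G Kˣ)

theorem infinite_left_or_right (hinf : Infinite (TwistedGroupAlgebra c)) :
    Infinite K ∨ Infinite G := by
  by_contra! h
  obtain ⟨h1, h2⟩ := h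
  have : Finite (G →₀ K) := Finite.of_injective _ DFunLike.coe_injective
  exact not_finite_iff_infinite.2 hinf this

theorem isUnipotentUnit_commute (hinf : Infinite (TwistedGroupAlgebra c))
    {y v : (TwistedGroupAlgebra c)ˣ} (hy : y ∈ fcCenter (TwistedGroupAlgebra c)ˣ)
    (hyu : IsUnipotentUnit y) (hv : v ∈ fcCenter (TwistedGroupAlgebra c)ˣ) :
    y * v = v * y := by
  suffices h : ((y : TwistedGroupAlgebra c) - 1) * v = v * (y - 1) by
    ext
    simpa [sub_mul, mul_sub] using h
  rcases infinite_left_or_right c hinf with hK | hG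
  · exact commute_of_infinite_isUnit_one_add_smul
      (infinite_isUnit_one_add_smul_of_isNilpotent (K := K) hyu) hv
  · refine commute_of_isNilpotent c hyu hv
      ((infinite_commute_u c ![y, v] (by simp [Fin.forall_fin_two, hy, hv])).mono fun g hg => ?_)
    exact ⟨(hg 0).sub_right (.one_right _), hg 1⟩

theorem isUnipotentUnit_commutator_of_finite [Finite K] [Infinite G]
    {a b : (TwistedGroupAlgebra c)ˣ} (ha : a ∈ torsionFCCenter (TwistedGroupAlgebra c)ˣ)
    (hb : b ∈ torsionFCCenter (TwistedGroupAlgebra c)ˣ) : IsUnipotentUnit ⁅a, b⁆ := by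
  let H : Subgroup (TwistedGroupAlgebra c)ˣ := Subgroup.closure {a, b}
  have hHfin : Finite H := finite_closure_pair_of_mem_torsionFCCenter ha hb
  let S : Submonoid (TwistedGroupAlgebra c) := H.toSubmonoid.map (Units.coeHom _)
  let B : Subalgebra K (TwistedGroupAlgebra c) := Algebra.adjoin K S
  have hS : (S : Set (TwistedGroupAlgebra c)).Finite :=
    (Set.toFinite (H : Set (TwistedGroupAlgebra c)ˣ)).image _
  have hBfin : Finite B := by
    have : Module.Finite K (Subalgebra.toSubmodule B) := by
      rw [Algebra.adjoin_eq_span, Submonoid.closure_eq]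
      exact Module.Finite.span_of_finite K hS
    exact Module.finite_of_finite K (M := Subalgebra.toSubmodule B)
  have hHB {h : (TwistedGroupAlgebra c)ˣ} (hh : h ∈ H) : (h : TwistedGroupAlgebra c) ∈ B :=
    Algebra.subset_adjoin ⟨h, hh, rfl⟩
  have hHle : H ≤ torsionFCCenter (TwistedGroupAlgebra c)ˣ := by
    refine (Subgroup.closure_le _).2 ?_
    rintro w (rfl | rfl)
    exacts [ha, hb]
  have hcen (w : TwistedGroupAlgebra c) (hw : ∀ h ∈ H, Commute w (h : TwistedGroupAlgebra c))
      (x : TwistedGroupAlgebra c) (hx : x ∈ B) : Commute w x := by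
    refine (Subalgebra.mem_centralizer_iff K).1 ((Algebra.adjoin_le ?_ : B ≤
      Subalgebra.centralizer K {w}) hx) w rfl
    rintro _ ⟨h, hh, rfl⟩
    exact (Subalgebra.mem_centralizer_iff K).2 fun _ hg => hg ▸ hw h hh
  have hW : {g | ∀ h : H, Commute (u c g) ((h : (TwistedGroupAlgebra c)ˣ) :
      TwistedGroupAlgebra c)}.Infinite :=
    infinite_commute_u c (fun h : H => (h : (TwistedGroupAlgebra c)ˣ)) fun h => (hHle h.2).1
  -- The infinitely many `u_g` that centralize `H` centralize its span `B`, hence also `e`; so `e`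
  -- commutes with each element of `H`, and therefore with `B`.
  have hidem (e : B) (he : IsIdempotentElem e) (x : B) : e * x = x * e := by
    refine Subtype.ext (hcen e (fun h hh => ?_) x x.2)
    exact commute_of_isIdempotentElem c (congrArg Subtype.val he) (hHle hh).1
      (hW.mono fun g (hg : ∀ k : H, Commute (u c g)
          ((k : (TwistedGroupAlgebra c)ˣ) : TwistedGroupAlgebra c)) =>
         ⟨hcen _ (fun k hk => hg ⟨k, hk⟩) e e.2, hg ⟨h, hh⟩⟩)
  have haH : a ∈ H := Subgroup.subset_closure (by simp)
  have hbH : b ∈ H := Subgroup.subset_closure (by simp)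
  let a' : B := ⟨a, hHB haH⟩
  let b' : B := ⟨b, hHB hbH⟩
  let d : B := ⟨_, hHB (mul_mem (inv_mem haH) (inv_mem hbH))⟩
  have hJ : (a' * b' - b' * a') * d ∈ Ring.jacobson B :=
    Ideal.mul_mem_right _ _ (Finite.mem_jacobson_of_isMulCentral_idempotents hidem a' b')
  obtain ⟨n, hn⟩ := IsSemiprimaryRing.isNilpotent (R := B)
  have h0 : ((a' * b' - b' * a') * d) ^ n = 0 := by
    have := Ideal.pow_mem_pow hJ n
    rwa [hn] at this
  refine ⟨n, ?_⟩
  -- Here `d = a⁻¹ * b⁻¹`, and `(a * b - b * a) * a⁻¹ * b⁻¹ = ⁅a, b⁆ - 1`.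
  have h1 : ((⁅a, b⁆ : (TwistedGroupAlgebra c)ˣ) : TwistedGroupAlgebra c) - 1 =
      ((a' * b' - b' * a') * d : B) := by
    simp [a', b', d, commutatorElement_def, sub_mul, mul_assoc]
  rw [h1]
  exact congrArg Subtype.val h0

theorem isUnipotentUnit_commutator (hinf : Infinite (TwistedGroupAlgebra c))
    {a b : (TwistedGroupAlgebra c)ˣ} (ha : a ∈ torsionFCCenter (TwistedGroupAlgebra c)ˣ)
    (hb : b ∈ torsionFCCenter (TwistedGroupAlgebra c)ˣ) : IsUnipotentUnit ⁅a, b⁆ := by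
  rcases finite_or_infinite K with hK | hK
  · have := (infinite_left_or_right c hinf).resolve_left (not_infinite_iff_finite.2 hK)
    exact isUnipotentUnit_commutator_of_finite c ha hb
  · obtain ⟨n, hn, han⟩ := ha.2.exists_pow_eq_one
    have hab : a * b = b * a := Units.ext (commute_of_infinite_isUnit_one_add_smul
      (infinite_isUnit_one_add_smul_of_pow_eq_one (K := K) hn
        (by rw [← Units.val_pow_eq_pow_val, han, Units.val_one])) hb.1)
    rw [commutatorElement_eq_one_iff_mul_comm.2 hab]
    simp [IsUnipotentUnit]

end TwistedGroupAlgebra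

theorem theorem1 {K G : Type*} [Field K] [Group G] (c : TwoCocycle G Kˣ)
    (hinf : Infinite (TwistedGroupAlgebra c)) :
    (∀ y ∈ fcCenter (TwistedGroupAlgebra c)ˣ, IsUnipotentUnit y →
      ∀ v ∈ fcCenter (TwistedGroupAlgebra c)ˣ, y * v = v * y) ∧
    (∀ y ∈ ⁅torsionFCCenter (TwistedGroupAlgebra c)ˣ, torsionFCCenter (TwistedGroupAlgebra c)ˣ⁆,
      IsUnipotentUnit y ∧ y ∈ fcCenter (TwistedGroupAlgebra c)ˣ ∧
        ∀ v ∈ fcCenter (TwistedGroupAlgebra c)ˣ, y * v = v * y) := by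
  have h1 : ∀ y ∈ fcCenter (TwistedGroupAlgebra c)ˣ, IsUnipotentUnit y →
      ∀ v ∈ fcCenter (TwistedGroupAlgebra c)ˣ, y * v = v * y := fun y hy hyu v hv =>
    TwistedGroupAlgebra.isUnipotentUnit_commute c hinf hy hyu hv
  refine ⟨h1, fun y hy => ?_⟩
  -- Products of unipotent units need not be unipotent in general; here the factors commute by the
  -- first assertion `h1`. So it is enough to treat the generators `⁅a, b⁆`.
  let P : Subgroup (TwistedGroupAlgebra c)ˣ :=
    { carrier := {y | y ∈ fcCenter (TwistedGroupAlgebra c)ˣ ∧ IsUnipotentUnit y}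
      one_mem' := ⟨one_mem _, by simp [IsUnipotentUnit]⟩
      mul_mem' := fun ha hb => ⟨mul_mem ha.1 hb.1, ha.2.mul hb.2 (h1 _ ha.1 ha.2 _ hb.1)⟩
      inv_mem' := fun ha => ⟨inv_mem ha.1, ha.2.inv⟩ }
  have hP : ⁅torsionFCCenter (TwistedGroupAlgebra c)ˣ,
      torsionFCCenter (TwistedGroupAlgebra c)ˣ⁆ ≤ P := by
    refine Subgroup.commutator_le.2 fun a ha b hb => ⟨?_,
      TwistedGroupAlgebra.isUnipotentUnit_commutator c hinf ha hb⟩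
    exact mul_mem (mul_mem (mul_mem ha.1 hb.1) (inv_mem ha.1)) (inv_mem hb.1)
  exact ⟨(hP hy).2, (hP hy).1, h1 y (hP hy).1 (hP hy).2⟩
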